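/- Let $G$ be a locally compact (Hausdorff) group. A $G$-algebra is a C*-algebra with a strongly continuous action of $G$ by $*$-automorphisms. A crossed-product functor $\rtimes_\mu$ for $G$ assigns to every $G$-algebra $A$ a C*-norm $\|\cdot\|_\mu$ on the convolution $*$-algebra $C_c(G,A)$ with $\|\cdot\|_r\le\|\cdot\|_\mu\le\|\cdot\|_{\max}$, with completion $A\rtimes_\mu G$, such that for every equivariant $*$-homomorphism $\varphi:A\to B$ the map $f\mapsto\varphi\circ f$ extends to a $*$-homomorphism $A\rtimes_\mu G\to B\rtimes_\mu G$. The functor has the *ideal property* if $I\rtimes_\mu G\to A\rtimes_\mu G$ is injective for every $G$-invariant closed ideal $I$ of a $G$-algebra $A$, and it is *functorial for cp maps* if for every equivariant completely positive map $\varphi:A\to B$ the map $f\mapsto\varphi\circ f$ extends to a completely positive map $A\rtimes_\mu G\to B\rtimes_\mu G$. For an equivariant surjective $*$-homomorphism $\pi:C\to A$ with kernel $I$, let $I\rtimes_{\mu,C}G$ be the closure of $C_c(G,I)$ in $C\rtimes_\mu G$, and let $\|\cdot\|_\pi$ be the norm on $C_c(G,A)$ induced by the inclusion $C_c(G,A)\hookrightarrow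 (C\rtimes_\mu G)/(I\rtimes_{\mu,C}G)$. Put $\|a\|_{\mathcal E(\mu)}:=\sup_\pi\|a\|_\pi$, the supremum being over all equivariant surjections $\pi:C\to A$ from $G$-algebras, and let $A\rtimes_{\mathcal E(\mu)}G$ be the completion of $C_c(G,A)$ in this norm. A $G$-algebra $A$ is *equivariantly projective* (resp. has the *WELP*) if for every $G$-algebra $B$, every $G$-invariant closed ideal $J$ of $B$ and every equivariant $*$-homomorphism $\varphi:A\to B/J$ there is an equivariant $*$-homomorphism (resp. an equivariant contractive completely positive map) $\widetilde\varphi:A\to B$ that lifts $\varphi$. It is *equivariantly projective in the unital category* (resp. has the *UWELP*) if it has this property with all C*-algebras and maps assumed unital. **Corollary.** Let $\rtimes_\mu$ be a crossed-product functor for $G$ and let $A$ be a $G$-algebra. 1. If $A$ is equivariantly projective, then $A\rtimes_\mu G=A\rtimes_{\mathcal E(\mu)}G$. 2. If $\rtimes_\mu$ has the ideal property and $A$ is equivariantly projective in the unital category, then $A\rtimes_\mu G=A\rtimes_{\mathcal E(\mu)}G$. 3. If $\rtimes_\mu$ is functorial for cp maps and $A$ has the WELP, then $A\rtimes_\mu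 G=A\rtimes_{\mathcal E(\mu)}G$. 4. If $\rtimes_\mu$ is functorial for cp maps and has the ideal property, and $A$ has the UWELP, then $A\rtimes_\mu G=A\rtimes_{\mathcal E(\mu)}G$. Here equality means that $\|\cdot\|_\mu=\|\cdot\|_{\mathcal E(\mu)}$ on $C_c(G,A)$, so that the two completions coincide. -/

import Mathlib

open scoped CompactlySupported CStarAlgebra NNReal

universe u

/-! ### `G`-algebras and their morphisms -/

/-- A `G`-algebra: a (not necessarily unital) C*-algebra with a strongly continuous action of the
topological group `G` by `*`-automorphisms. -/
structure GAlgebra (G : Type u) [Group G] [TopologicalSpace G] where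
  carrier : Type u
  [cstar : NonUnitalCStarAlgebra carrier]
  act : G →* (carrier ≃⋆ₐ[ℂ] carrier)
  continuous_act : ∀ a : carrier, Continuous fun g => act g a

namespace GAlgebra

instance {G : Type u} [Group G] [TopologicalSpace G] : CoeSort (GAlgebra G) (Type u) :=
  ⟨GAlgebra.carrier⟩

attribute [instance] GAlgebra.cstar

section

variable {G : Type u} [Group G] [TopologicalSpace G]

/-- C*-algebras carry their usual order (`0 ≤ a` iff `a = star b * b` for some `b`). -/
noncomputable instance (A : GAlgebra G) : PartialOrder A := CStarAlgebra.spectralOrder _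

instance (A : GAlgebra G) : StarOrderedRing A := CStarAlgebra.spectralOrderedRing _

/-- Equivariant `*`-homomorphisms. -/
structure Hom (A B : GAlgebra G) where
  toHom : A →⋆ₙₐ[ℂ] B
  equivariant : ∀ (g : G) (a : A), toHom (A.act g a) = B.act g (toHom a)

instance (A B : GAlgebra G) : CoeFun (Hom A B) (fun _ => A → B) := ⟨fun φ => φ.toHom⟩

/-- Equivariant completely positive maps. -/
structure CPHom (A B : GAlgebra G) where
  toCP : A →CP B
  equivariant : ∀ (g : G) (a : A), toCP (A.act g a) = B.act g (toCP a)

noncomputable instance (A B : GAlgebra G) : CoeFun (CPHom A B) (fun _ => A → B) := ⟨fun φ => φ.toCP⟩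

/-- Contractivity; a contractive completely positive map is called ccp. -/
def CPHom.IsContractive {A B : GAlgebra G} (φ : CPHom A B) : Prop :=
  ∀ a : A, ‖φ a‖ ≤ ‖a‖

theorem Hom.continuous {A B : GAlgebra G} (φ : Hom A B) : Continuous φ :=
  map_continuous φ.toHom

theorem CPHom.continuous {A B : GAlgebra G} (φ : CPHom A B) : Continuous φ :=
  map_continuous φ.toCP

/-- `e` is a (hence the) unit of `A`. -/
def IsUnitElement {A : GAlgebra G} (e : A) : Prop :=
  ∀ a : A, e * a = a ∧ a * e = a

/-- `A` is a unital C*-algebra. -/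
def IsUnital (A : GAlgebra G) : Prop := ∃ e : A, IsUnitElement e

/-- A map between `G`-algebras sending the unit (if there is one) to a unit. -/
def PreservesUnit {A B : GAlgebra G} (φ : A → B) : Prop :=
  ∀ e : A, IsUnitElement e → IsUnitElement (φ e)

/-! ### Lifting properties

Quotients `B → B/J` by invariant closed ideals are, up to equivariant isomorphism, the same thing
as equivariant surjective `*`-homomorphisms `q : B → Q` between `G`-algebras. -/

/-- Equivariant projectivity: equivariant `*`-homomorphisms into quotients lift to equivariant
`*`-homomorphisms. -/
def EquivariantlyProjective (A : GAlgebra G) : Prop :=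
  ∀ (B Q : GAlgebra G) (q : Hom B Q), Function.Surjective q →
    ∀ φ : Hom A Q, ∃ ψ : Hom A B, ∀ a, q (ψ a) = φ a

/-- Equivariant projectivity in the unital category: all algebras and maps are unital. -/
def UnitallyEquivariantlyProjective (A : GAlgebra G) : Prop :=
  A.IsUnital ∧
  ∀ (B Q : GAlgebra G), B.IsUnital → Q.IsUnital →
    ∀ q : Hom B Q, PreservesUnit q → Function.Surjective q →
    ∀ φ : Hom A Q, PreservesUnit φ →
      ∃ ψ : Hom A B, PreservesUnit ψ ∧ ∀ a, q (ψ a) = φ a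

/-- The weak equivariant lifting property: equivariant `*`-homomorphisms into quotients lift to
equivariant ccp maps. -/
def WELP (A : GAlgebra G) : Prop :=
  ∀ (B Q : GAlgebra G) (q : Hom B Q), Function.Surjective q →
    ∀ φ : Hom A Q, ∃ ψ : CPHom A B, ψ.IsContractive ∧ ∀ a, q (ψ a) = φ a

/-- The unital weak equivariant lifting property: all algebras and maps are unital. -/
def UWELP (A : GAlgebra G) : Prop :=
  A.IsUnital ∧
  ∀ (B Q : GAlgebra G), B.IsUnital → Q.IsUnital →
    ∀ q : Hom B Q, PreservesUnit q → Function.Surjective q →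
    ∀ φ : Hom A Q, PreservesUnit φ →
      ∃ ψ : CPHom A B, ψ.IsContractive ∧ PreservesUnit ψ ∧ ∀ a, q (ψ a) = φ a

end

/-! ### The convolution `*`-algebra `C_c(G, A)` -/

section Convolution

open scoped Pointwise

variable {G : Type u} [Group G] [TopologicalSpace G] {A : GAlgebra G}

theorem norm_act (g : G) (a : A) : ‖A.act g a‖ = ‖a‖ :=
  NonUnitalStarAlgHom.norm_map (A.act g) (A.act g).injective a

/-- The action is jointly continuous. -/
theorem continuous_act_uncurry : Continuous fun p : G × A => A.act p.1 p.2 := by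
  rw [continuous_iff_continuousAt]
  rintro ⟨g, a⟩
  rw [ContinuousAt, tendsto_iff_norm_sub_tendsto_zero]
  have h1 : Filter.Tendsto (fun p : G × A => ‖p.2 - a‖ + ‖A.act p.1 a - A.act g a‖)
      (nhds (g, a)) (nhds 0) := by
    have : Continuous fun p : G × A => ‖p.2 - a‖ + ‖A.act p.1 a - A.act g a‖ :=
      (continuous_snd.sub continuous_const).norm.add
        (((A.continuous_act a).comp continuous_fst).sub continuous_const).norm
    simpa using this.tendsto (g, a)
  refine squeeze_zero (fun _ => norm_nonneg _) (fun p => ?_) h1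
  have : A.act p.1 p.2 - A.act g a = A.act p.1 (p.2 - a) + (A.act p.1 a - A.act g a) := by
    rw [map_sub]; abel
  rw [this]
  exact (norm_add_le _ _).trans (by rw [norm_act])

/-- Composition of a compactly supported continuous function with a continuous map fixing `0`. -/
def postcomp {X Y : Type u} [TopologicalSpace X] [TopologicalSpace Y] [Zero X] [Zero Y]
    (φ : X → Y) (hφ : Continuous φ) (h0 : φ 0 = 0) (f : C_c(G, X)) : C_c(G, Y) where
  toFun := fun s => φ (f s)
  continuous_toFun := hφ.comp f.continuous
  hasCompactSupport' := f.hasCompactSupport.comp_left h0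

/-- The map `C_c(G, A) → C_c(G, B)`, `f ↦ φ ∘ f`, induced by an equivariant `*`-homomorphism. -/
def Hom.onCc {B : GAlgebra G} (φ : Hom A B) (f : C_c(G, A)) : C_c(G, B) :=
  postcomp φ φ.continuous (map_zero φ.toHom) f

/-- The map `C_c(G, A) → C_c(G, B)`, `f ↦ φ ∘ f`, induced by an equivariant cp map. -/
noncomputable def CPHom.onCc {B : GAlgebra G} (φ : CPHom A B) (f : C_c(G, A)) : C_c(G, B) :=
  postcomp φ φ.continuous (map_zero φ.toCP) f

variable [IsTopologicalGroup G] [LocallyCompactSpace G]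

/-- The modular function is continuous. -/
theorem continuous_modularCharacterFun :
    Continuous (MeasureTheory.Measure.modularCharacterFun : G → ℝ≥0) := by
  borelize G
  obtain ⟨⟨f, f_cont⟩, f_comp, f_nonneg, f_one⟩ :
    ∃ f : C(G, ℝ), HasCompactSupport f ∧ 0 ≤ f ∧ f 1 ≠ 0 := exists_continuous_nonneg_pos 1
  have int_ne : ∫ x, f x ∂(MeasureTheory.Measure.haar : MeasureTheory.Measure G) ≠ 0 :=
    ne_of_gt (f_cont.integral_pos_of_hasCompactSupport_nonneg_nonzero f_comp f_nonneg f_one)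
  rw [NNReal.isEmbedding_coe.continuous_iff]
  have key : ∀ g : G, ((MeasureTheory.Measure.modularCharacterFun g : ℝ≥0) : ℝ)
      = (∫ x, f (x * g) ∂MeasureTheory.Measure.haar) / ∫ x, f x ∂MeasureTheory.Measure.haar := by
    intro g
    rw [MeasureTheory.Measure.modularCharacterFun_eq_haarScalarFactor MeasureTheory.Measure.haar g,
      MeasureTheory.Measure.haarScalarFactor_eq_integral_div _ _ f_cont f_comp int_ne,
      MeasureTheory.integral_map (AEMeasurable.mul_const aemeasurable_id' _)
        (Continuous.aestronglyMeasurable f_cont)]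
  have : (fun g : G => ((MeasureTheory.Measure.modularCharacterFun g : ℝ≥0) : ℝ))
      = fun g => (∫ x, f (x * g) ∂MeasureTheory.Measure.haar) /
          ∫ x, f x ∂MeasureTheory.Measure.haar := funext key
  change Continuous (fun g : G => ((MeasureTheory.Measure.modularCharacterFun g : ℝ≥0) : ℝ))
  rw [this]
  refine Continuous.div_const ?_ _
  rw [continuous_iff_continuousAt]
  intro g₀
  obtain ⟨t, t_comp, ht⟩ : ∃ t, IsCompact t ∧ t ∈ nhds g₀ := exists_compact_mem_nhds g₀
  have hk : IsCompact (tsupport f * t⁻¹) := f_comp.isCompact.mul t_comp.inv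
  have hc : ContinuousOn (fun g : G => ∫ x, f (x * g) ∂MeasureTheory.Measure.haar) t := by
    refine continuousOn_integral_of_compact_support hk
      (f_cont.comp (continuous_snd.mul continuous_fst)).continuousOn ?_
    intro p x hp hx
    contrapose! hx
    exact ⟨x * p, subset_tsupport _ hx, p⁻¹, by simpa using hp, by simp⟩
  exact hc.continuousAt ht

variable [MeasurableSpace G] [BorelSpace G]

open MeasureTheory MeasureTheory.Measure

/-- Convolution with respect to (left) Haar measure:
`(f * g)(s) = ∫ f(t) α_t(g(t⁻¹ s)) dt`. -/
noncomputable def conv (f g : C_c(G, A)) : C_c(G, A) where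
  toFun := fun s => ∫ t, f t * A.act t (g (t⁻¹ * s)) ∂haar
  continuous_toFun := by
    rw [← continuousOn_univ]
    refine continuousOn_integral_of_compact_support f.hasCompactSupport.isCompact ?_ ?_
    · refine Continuous.continuousOn ?_
      have h1 : Continuous fun p : G × G => f p.2 := f.continuous.comp continuous_snd
      have h2 : Continuous fun p : G × G => g (p.2⁻¹ * p.1) :=
        g.continuous.comp (continuous_snd.inv.mul continuous_fst)
      exact h1.mul (continuous_act_uncurry.comp (continuous_snd.prodMk h2))
    · intro s t _ ht
      rw [image_eq_zero_of_notMem_tsupport ht, zero_mul]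
  hasCompactSupport' := by
    refine HasCompactSupport.of_support_subset_isCompact
      (f.hasCompactSupport.isCompact.mul g.hasCompactSupport.isCompact) ?_
    intro s hs
    by_contra hcon
    refine hs ?_
    have : ∀ t, f t * A.act t (g (t⁻¹ * s)) = 0 := by
      intro t
      by_cases ht : t ∈ tsupport f
      · have : t⁻¹ * s ∉ tsupport g := fun h => hcon ⟨t, ht, t⁻¹ * s, h, by simp⟩
        rw [image_eq_zero_of_notMem_tsupport this, map_zero, mul_zero]
      · rw [image_eq_zero_of_notMem_tsupport ht, zero_mul]
    simp [this]

/-- The involution `f^*(s) = Δ(s)⁻¹ α_s(f(s⁻¹)^*)`, where `Δ` is the modular function normalised by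
`∫ f(s) ds = Δ(r) ∫ f(s r) ds`. This `Δ` is the inverse of the one in Mathlib, which is normalised
by `∫ f(s r) ds = modularCharacterFun r * ∫ f(s) ds`. -/
noncomputable def invol (f : C_c(G, A)) : C_c(G, A) where
  toFun := fun s => (modularCharacterFun s : ℝ) • A.act s (star (f s⁻¹))
  continuous_toFun := by
    have h1 : Continuous fun s : G => ((modularCharacterFun s : ℝ≥0) : ℝ) :=
      NNReal.continuous_coe.comp continuous_modularCharacterFun
    have h2 : Continuous fun s : G => star (f s⁻¹) := (f.continuous.comp continuous_inv).star
    exact h1.smul (continuous_act_uncurry.comp (continuous_id.prodMk h2))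
  hasCompactSupport' := by
    refine HasCompactSupport.of_support_subset_isCompact f.hasCompactSupport.isCompact.inv ?_
    intro s hs
    by_contra hcon
    refine hs ?_
    have : s⁻¹ ∉ tsupport f := fun h => hcon (by simpa using h)
    simp [image_eq_zero_of_notMem_tsupport this]

/-! ### The maximal and the reduced norm -/

variable (A) in
/-- A covariant representation of `(A, G)` on a Hilbert space. -/
structure CovariantRep where
  H : Type u
  [normedAddCommGroup : NormedAddCommGroup H]
  [innerProductSpace : InnerProductSpace ℂ H]
  [completeSpace : CompleteSpace H]
  π : A →⋆ₙₐ[ℂ] (H →L[ℂ] H)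
  U : G →* unitary (H →L[ℂ] H)
  continuous_U : ∀ ξ : H, Continuous fun s => (U s : H →L[ℂ] H) ξ
  covariant : ∀ (s : G) (a : A),
    π (A.act s a) = (U s : H →L[ℂ] H) * π a * star (U s : H →L[ℂ] H)

attribute [instance] CovariantRep.normedAddCommGroup CovariantRep.innerProductSpace
  CovariantRep.completeSpace

/-- The integrated form `(π ⋊ U)(f) ξ = ∫ π(f(s)) U_s ξ ds`. -/
noncomputable def CovariantRep.integrated (R : CovariantRep A) (f : C_c(G, A)) (ξ : R.H) : R.H :=
  ∫ s, R.π (f s) ((R.U s : R.H →L[ℂ] R.H) ξ) ∂haar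

/-- The maximal norm `‖f‖_max`: the supremum of the operator norms of `(π ⋊ U)(f)` over all
covariant representations `(π, U)`. -/
noncomputable def maxNorm (f : C_c(G, A)) : ℝ :=
  sSup {r | ∃ (R : CovariantRep A) (ξ : R.H), ‖ξ‖ ≤ 1 ∧ r = ‖R.integrated f ξ‖}

/-- The norm on `C_c(G, A)` as a dense subspace of the Hilbert `A`-module `L²(G, A)`, that is
`‖ξ‖ = ‖∫ ξ(t)^* ξ(t) dt‖^(1/2)`. -/
noncomputable def l2Norm (ξ : G → A) : ℝ :=
  Real.sqrt ‖∫ t, star (ξ t) * ξ t ∂haar‖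

/-- The regular representation of `C_c(G, A)` on `L²(G, A)`: the integrated form of
`(a ξ)(t) = α_{t⁻¹}(a) ξ(t)` and `(λ_s ξ)(t) = ξ(s⁻¹ t)`. -/
noncomputable def regularRep (f : C_c(G, A)) (ξ : C_c(G, A)) : G → A :=
  fun t => ∫ s, A.act t⁻¹ (f s) * ξ (s⁻¹ * t) ∂haar

/-- The reduced norm `‖f‖_r`: the operator norm of `f` in the regular representation. -/
noncomputable def reducedNorm (f : C_c(G, A)) : ℝ :=
  sInf {M | 0 ≤ M ∧ ∀ ξ : C_c(G, A), l2Norm (regularRep f ξ) ≤ M * l2Norm ξ}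

/-- `D`, with the map `i : C_c(G, A) → D`, is the C*-algebra completion of the convolution
`*`-algebra `C_c(G, A)` in the norm `N`. -/
structure IsCStarCompletion (N : C_c(G, A) → ℝ) {D : Type u} [NonUnitalCStarAlgebra D]
    (i : C_c(G, A) →ₗ[ℂ] D) : Prop where
  map_conv : ∀ f g, i (conv f g) = i f * i g
  map_invol : ∀ f, i (invol f) = star (i f)
  norm_eq : ∀ f, ‖i f‖ = N f
  denseRange : DenseRange i

end Convolution
end GAlgebra

/-! ### Crossed-product functors -/

section CrossedProduct

variable (G : Type u) [Group G] [TopologicalSpace G] [IsTopologicalGroup G]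
  [LocallyCompactSpace G] [MeasurableSpace G] [BorelSpace G]

/-- A crossed-product functor `A ↦ A ⋊_μ G`: for every `G`-algebra `A` a C*-norm on `C_c(G, A)`
between the reduced and the maximal one, with completion `A ⋊_μ G`, such that for every equivariant
`*`-homomorphism `φ : A → B` the map `f ↦ φ ∘ f` extends to a `*`-homomorphism
`A ⋊_μ G → B ⋊_μ G`. (By density this extension is unique, hence compatible with composition and
identities.) -/
structure CrossedProductFunctor where
  norm : ∀ A : GAlgebra G, C_c(G, A) → ℝ
  reducedNorm_le : ∀ (A : GAlgebra G) (f : C_c(G, A)), GAlgebra.reducedNorm f ≤ norm A f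
  le_maxNorm : ∀ (A : GAlgebra G) (f : C_c(G, A)), norm A f ≤ GAlgebra.maxNorm f
  alg : GAlgebra G → Type u
  [cstar : ∀ A, NonUnitalCStarAlgebra (alg A)]
  inc : ∀ A : GAlgebra G, C_c(G, A) →ₗ[ℂ] alg A
  isCompletion : ∀ A : GAlgebra G, GAlgebra.IsCStarCompletion (norm A) (inc A)
  map : ∀ {A B : GAlgebra G}, GAlgebra.Hom A B → (alg A →⋆ₙₐ[ℂ] alg B)
  map_inc : ∀ {A B : GAlgebra G} (φ : GAlgebra.Hom A B) (f : C_c(G, A)),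
    map φ (inc A f) = inc B (φ.onCc f)

namespace CrossedProductFunctor

attribute [instance] CrossedProductFunctor.cstar

variable {G} (μ : CrossedProductFunctor G)

noncomputable instance (A : GAlgebra G) : PartialOrder (μ.alg A) := CStarAlgebra.spectralOrder _

instance (A : GAlgebra G) : StarOrderedRing (μ.alg A) := CStarAlgebra.spectralOrderedRing _

/-- The ideal property: for an invariant ideal `I` of `A` the map `I ⋊_μ G → A ⋊_μ G` is
injective. Ideals are given by injective equivariant `*`-homomorphisms with an ideal as image. -/
def IdealProperty : Prop :=
  ∀ (I A : GAlgebra G) (j : GAlgebra.Hom I A), Function.Injective j →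
    (∀ (a : A) (x : I), (∃ y, j y = a * j x) ∧ ∃ y, j y = j x * a) →
    Function.Injective (μ.map j)

/-- Functoriality for completely positive maps: for every equivariant cp map `φ : A → B` the map
`f ↦ φ ∘ f` extends to a cp map `A ⋊_μ G → B ⋊_μ G`. -/
def FunctorialForCP : Prop :=
  ∀ (A B : GAlgebra G) (φ : GAlgebra.CPHom A B),
    ∃ Φ : μ.alg A →CP μ.alg B, ∀ f : C_c(G, A), Φ (μ.inc A f) = μ.inc B (φ.onCc f)

/-- For `π : C → A` with kernel `I`, this is `I ⋊_{μ,C} G`: the closure of `C_c(G, I)` in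
`C ⋊_μ G`. -/
noncomputable def relKernel {C A : GAlgebra G} (π : GAlgebra.Hom C A) : Submodule ℂ (μ.alg C) :=
  (Submodule.span ℂ {x | ∃ f : C_c(G, C), (∀ s, π (f s) = 0) ∧ x = μ.inc C f}).topologicalClosure

/-- The `π`-norm on `C_c(G, A)` of an equivariant surjection `π : C → A` with kernel `I`: the
quotient norm of the class of `c` in `(C ⋊_μ G) / (I ⋊_{μ,C} G)`, where `c ∈ C_c(G, C)` is any lift
of `a`. (The class does not depend on the lift, so the set below has just one element.) -/
noncomputable def piNorm {C A : GAlgebra G} (π : GAlgebra.Hom C A) (a : C_c(G, A)) : ℝ :=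
  sInf {r | ∃ c : C_c(G, C), π.onCc c = a ∧
    r = ‖(Submodule.Quotient.mk (μ.inc C c) : μ.alg C ⧸ μ.relKernel π)‖}

/-- The `E(μ)`-norm on `C_c(G, A)`: the supremum of the `π`-norms over all equivariant surjections
`π : C → A`. -/
noncomputable def exactNorm (A : GAlgebra G) (a : C_c(G, A)) : ℝ :=
  sSup {r | ∃ (C : GAlgebra G) (π : GAlgebra.Hom C A), Function.Surjective π ∧ r = μ.piNorm π a}

end CrossedProductFunctor
end CrossedProduct

/-! ### Approximate units and quotient norms in C*-algebras -/

/-! The surjection `π = id` contributes exactly the `μ`-norm to the supremum defining the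
`E(μ)`-norm, so everything rests on showing that no surjection `π : C → A` has a larger `π`-norm
(`exactNorm_eq_norm`). For this a function `a` must be lifted to `C_c(G, C)` with quotient norm
almost at most `‖a‖_μ`, and the lifting property, applied to `id_A`, provides a section `ψ` of `π`.

If `ψ` is a homomorphism, `ψ ∘ a` is such a lift because `*`-homomorphisms are contractive. If `ψ`
is only cp, the extension `Φ` to crossed products comes without a norm bound. Since `π ∘ ψ = id`,
however, `Φ` is a `*`-homomorphism modulo the relative kernel, and a bounded map of this kind is
contractive modulo that ideal: the C*-inequality for the quotient norm (`norm_quotient_mk_sq_le`)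
permits repeated squaring, and the bound `‖Φ‖` disappears in the limit
(`norm_quotient_mk_apply_le`).

In the unital cases sections exist only for the extension of `π` to the unitization of `C`, whose
kernel is larger. They give a lift `d` with values in the unitization. By the ideal property `C ⋊_μ
G` sits there isometrically, and it absorbs products: for an approximate unit `f` of `C ⋊_μ G`, the
function `f * d` is `C`-valued and agrees with `f * c` modulo functions killed by `π`, for any lift
`c` in `C_c(G, C)`. Hence the class of `c` has norm at most `‖d‖` (`IdealProperty.norm_mk_le`). -/

theorem norm_one_sub_star_mul_self_le {B : Type*} [CStarAlgebra B] {b : B}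
    (hb : ‖star b * b‖ ≤ 1) : ‖1 - star b * b‖ ≤ 1 := by
  let _ : PartialOrder B := CStarAlgebra.spectralOrder B
  have _ : StarOrderedRing B := CStarAlgebra.spectralOrderedRing B
  have h0 : 0 ≤ star b * b := star_mul_self_nonneg b
  have h1 : star b * b ≤ 1 := (CStarAlgebra.norm_le_one_iff_of_nonneg _ h0).1 hb
  have h2 : 0 ≤ 1 - star b * b := sub_nonneg.2 h1
  rw [CStarAlgebra.norm_le_one_iff_of_nonneg _ h2]
  exact sub_le_self _ h0

/-- The positive contraction is recorded as `star b * b`, so that no choice of order enters the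
statement and the element can be moved from a subalgebra to the ambient algebra. -/
theorem exists_star_mul_self_approx_unit {B : Type*} [NonUnitalCStarAlgebra B] (x : B) {ε : ℝ}
    (hε : 0 < ε) :
    ∃ b : B, ‖star b * b‖ ≤ 1 ∧ ‖star b * b * x - x‖ < ε ∧ ‖x * (star b * b) - x‖ < ε := by
  let _ : PartialOrder B := CStarAlgebra.spectralOrder B
  have _ : StarOrderedRing B := CStarAlgebra.spectralOrderedRing B
  have h := CStarAlgebra.increasingApproximateUnit B
  have h1 := (Metric.tendsto_nhds.1 (h.tendsto_mul_right x)) ε hε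
  have h2 := (Metric.tendsto_nhds.1 (h.tendsto_mul_left x)) ε hε
  obtain ⟨e, he1, he2, he3, he4⟩ :=
    (h.eventually_nonneg.and (h.eventually_norm.and (h1.and h2))).exists
  obtain ⟨b, rfl⟩ := CStarAlgebra.nonneg_iff_eq_star_mul_self.1 he1
  rw [dist_eq_norm] at he3 he4
  exact ⟨b, he2, he3, he4⟩

/-- The C*-inequality for the quotient norm of a closed self-adjoint ideal. -/
theorem norm_quotient_mk_sq_le {D : Type*} [NonUnitalCStarAlgebra D] (J : Submodule ℂ D)
    (hJ : IsClosed (J : Set D)) (hl : ∀ x, ∀ y ∈ J, x * y ∈ J) (hs : ∀ y ∈ J, star y ∈ J) (y : D) :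
    ‖(Submodule.Quotient.mk y : D ⧸ J)‖ ^ 2 ≤
      ‖(Submodule.Quotient.mk (star y * y) : D ⧸ J)‖ := by
  refine le_of_forall_pos_le_add fun ε hε => ?_
  obtain ⟨z, hz, hzn⟩ := Submodule.Quotient.norm_mk_lt
    (Submodule.Quotient.mk (star y * y) : D ⧸ J) (half_pos hε)
  have hk : z - star y * y ∈ J := (Submodule.Quotient.eq J).1 hz
  set k := z - star y * y with hkdef
  -- `J` is a C*-algebra in its own right, so the approximate unit for `k` can be taken inside `J`.
  let S : NonUnitalStarSubalgebra ℂ D :=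
    { J with
      mul_mem' := fun {a b} _ hb => hl a b hb
      star_mem' := fun {a} ha => hs a ha }
  have _ : IsClosed (S : Set D) := hJ
  obtain ⟨b, hb1, -, hb2⟩ := exists_star_mul_self_approx_unit (⟨k, hk⟩ : S) (half_pos hε)
  have hbJ : (b : D) ∈ J := b.2
  replace hb1 : ‖star (b : D) * b‖ ≤ 1 := hb1
  replace hb2 : ‖k * (star (b : D) * b) - k‖ < ε / 2 := hb2
  generalize (b : D) = b at hb1 hb2 hbJ
  -- `w` is a self-adjoint contraction with `y * w ≡ y` modulo `J` and `k * w` small. Thus `‖y w‖² =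
  -- ‖w (star y * y) w‖ ≤ ‖w z w‖ + ‖w k w‖`, where `‖z‖` is close to the quotient norm of `star y *
  -- y`.
  set w : Unitization ℂ D := 1 - star (b : Unitization ℂ D) * (b : Unitization ℂ D) with hw
  have hw1 : ‖w‖ ≤ 1 := by
    refine norm_one_sub_star_mul_self_le ?_
    rw [← Unitization.inr_star, ← Unitization.inr_mul, Unitization.norm_inr]
    exact hb1
  have hws : star w = w := by simp [hw]
  have h1 : ‖(Submodule.Quotient.mk y : D ⧸ J)‖ ≤ ‖(y : Unitization ℂ D) * w‖ := by
    have e1 : (Submodule.Quotient.mk y : D ⧸ J)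
        = Submodule.Quotient.mk (y - y * (star b * b)) := by
      rw [Submodule.Quotient.eq, sub_sub_cancel]
      exact hl _ _ (hl _ _ hbJ)
    have e2 : (y : Unitization ℂ D) * w = ((y - y * (star b * b) : D) : Unitization ℂ D) := by
      simp [hw, mul_sub, Unitization.inr_sub]
    rw [e1, e2, Unitization.norm_inr]
    exact Submodule.Quotient.norm_mk_le _ _
  have h2 : ‖(y : Unitization ℂ D) * w‖ ^ 2 ≤ ‖z‖ + ‖(k : Unitization ℂ D) * w‖ := by
    rw [sq, ← CStarRing.norm_star_mul_self]
    have e : star ((y : Unitization ℂ D) * w) * ((y : Unitization ℂ D) * w)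
        = w * ((z : Unitization ℂ D) * w) - w * ((k : Unitization ℂ D) * w) := by
      rw [hkdef, Unitization.inr_sub, star_mul, hws]
      simp only [Unitization.inr_mul, Unitization.inr_star]
      noncomm_ring
    rw [e]
    refine (norm_sub_le _ _).trans (add_le_add ?_ ?_)
    · calc ‖w * ((z : Unitization ℂ D) * w)‖
          ≤ ‖w‖ * (‖(z : Unitization ℂ D)‖ * ‖w‖) :=
            (norm_mul_le _ _).trans (by gcongr; exact norm_mul_le _ _)
        _ ≤ 1 * (‖(z : Unitization ℂ D)‖ * 1) := by gcongr
        _ = ‖z‖ := by rw [Unitization.norm_inr]; ring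
    · calc ‖w * ((k : Unitization ℂ D) * w)‖ ≤ ‖w‖ * ‖(k : Unitization ℂ D) * w‖ :=
            norm_mul_le _ _
        _ ≤ 1 * ‖(k : Unitization ℂ D) * w‖ := by gcongr
        _ = _ := one_mul _
  have h3 : ‖(k : Unitization ℂ D) * w‖ < ε / 2 := by
    have e : (k : Unitization ℂ D) * w = ((k - k * (star b * b) : D) : Unitization ℂ D) := by
      simp only [hw, mul_sub, mul_one, Unitization.inr_sub, Unitization.inr_mul,
        Unitization.inr_star]
    rw [e, Unitization.norm_inr, norm_sub_rev]
    exact hb2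
  have h4 := pow_le_pow_left₀ (norm_nonneg _) h1 2
  linarith

/-- Taking `2 ^ n`-th roots removes `K`; equivalently, powers of `a / b > 1` would exceed `K`. -/
theorem le_of_forall_pow_two_pow_le {a b K : ℝ} (hb : 0 ≤ b)
    (h : ∀ n : ℕ, a ^ 2 ^ n ≤ K * b ^ 2 ^ n) : a ≤ b := by
  by_contra! hab
  rcases hb.eq_or_lt with rfl | hb
  · have := h 0
    simp at this
    linarith
  · have h1 : 1 < a / b := (one_lt_div hb).2 hab
    obtain ⟨n, hn⟩ := pow_unbounded_of_one_lt K h1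
    have h2 : (a / b) ^ 2 ^ n ≤ K := by
      rw [div_pow, div_le_iff₀ (pow_pos hb _)]
      exact h n
    have h3 : (a / b) ^ n ≤ (a / b) ^ 2 ^ n := pow_le_pow_right₀ h1.le Nat.lt_two_pow_self.le
    linarith

/-- A bounded linear map into a C*-algebra which is a `*`-homomorphism modulo a closed self-adjoint
ideal is contractive modulo this ideal. -/
theorem norm_quotient_mk_apply_le {B D : Type*} [NonUnitalCStarAlgebra B] [NonUnitalCStarAlgebra D]
    (J : Submodule ℂ D) (hJ : IsClosed (J : Set D)) (hl : ∀ x, ∀ y ∈ J, x * y ∈ J)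
    (hs : ∀ y ∈ J, star y ∈ J) (Φ : B →L[ℂ] D)
    (hΦ : ∀ x, Φ (star x * x) - star (Φ x) * Φ x ∈ J) (x : B) :
    ‖(Submodule.Quotient.mk (Φ x) : D ⧸ J)‖ ≤ ‖x‖ := by
  refine le_of_forall_pow_two_pow_le (K := ‖Φ‖) (norm_nonneg _) fun n => ?_
  -- Each step replaces `x` by `star x * x` and doubles the exponent, so the factor `‖Φ‖` enters
  -- only once, at `n = 0`.
  induction n generalizing x with
  | zero => simpa using (Submodule.Quotient.norm_mk_le _ _).trans (Φ.le_opNorm x)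
  | succ n ih =>
    have h1 := norm_quotient_mk_sq_le J hJ hl hs (Φ x)
    rw [← (Submodule.Quotient.eq J).2 (hΦ x)] at h1
    rw [pow_succ', pow_mul, pow_mul]
    calc _ ≤ ‖(Submodule.Quotient.mk (Φ (star x * x)) : D ⧸ J)‖ ^ 2 ^ n :=
          pow_le_pow_left₀ (by positivity) h1 _
      _ ≤ ‖Φ‖ * ‖star x * x‖ ^ 2 ^ n := ih _
      _ = _ := by rw [CStarRing.norm_star_mul_self, sq]

/-! ### Induced maps on the convolution algebra -/

namespace GAlgebra

section Functoriality

open MeasureTheory MeasureTheory.Measure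

variable {G : Type u} [Group G] [TopologicalSpace G] {A B : GAlgebra G}

@[simp] theorem Hom.onCc_apply (φ : Hom A B) (f : C_c(G, A)) (s : G) : φ.onCc f s = φ (f s) := rfl

@[simp] theorem CPHom.onCc_apply (φ : CPHom A B) (f : C_c(G, A)) (s : G) :
    φ.onCc f s = φ (f s) := rfl

theorem Hom.onCc_sub (φ : Hom A B) (f g : C_c(G, A)) : φ.onCc (f - g) = φ.onCc f - φ.onCc g := by
  ext s
  simp

theorem Hom.onCc_add (φ : Hom A B) (f g : C_c(G, A)) : φ.onCc (f + g) = φ.onCc f + φ.onCc g := by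
  ext s
  simp

theorem Hom.onCc_eq_zero_iff (π : Hom A B) (f : C_c(G, A)) : π.onCc f = 0 ↔ ∀ s, π (f s) = 0 :=
  ⟨fun h s => by simpa using DFunLike.congr_fun h s, fun h => by ext s; simpa using h s⟩

/-- The identity of a `G`-algebra. -/
def Hom.id (A : GAlgebra G) : Hom A A where
  toHom := NonUnitalStarAlgHom.id ℂ A
  equivariant _ _ := rfl

theorem isUnitElement_unique {e e' : A} (he : IsUnitElement e) (he' : IsUnitElement e') :
    e = e' :=
  ((he' e).2).symm.trans (he e').1

theorem IsUnitElement.star_eq {e : A} (he : IsUnitElement e) : star e = e := by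
  refine isUnitElement_unique (fun a => ⟨?_, ?_⟩) he
  · simpa using congrArg star (he (star a)).2
  · simpa using congrArg star (he (star a)).1

theorem IsUnitElement.act_eq {e : A} (he : IsUnitElement e) (g : G) : A.act g e = e := by
  refine isUnitElement_unique (fun a => ?_) he
  obtain ⟨b, rfl⟩ : ∃ b, A.act g b = a := (A.act g).surjective a
  rw [← map_mul, ← map_mul, (he b).1, (he b).2]
  exact ⟨rfl, rfl⟩

variable [IsTopologicalGroup G] [LocallyCompactSpace G]

theorem invol_apply (f : C_c(G, A)) (s : G) :
    invol f s = (modularCharacterFun s : ℝ) • A.act s (star (f s⁻¹)) := rfl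

theorem Hom.onCc_invol (φ : Hom A B) (f : C_c(G, A)) :
    φ.onCc (invol f) = invol (φ.onCc f) := by
  ext s
  rw [Hom.onCc_apply, invol_apply, invol_apply, map_real_smul φ.toHom φ.continuous,
    φ.equivariant, map_star, Hom.onCc_apply]

theorem invol_zero : invol (0 : C_c(G, A)) = 0 := by
  ext s
  simp [invol_apply]

variable [MeasurableSpace G] [BorelSpace G]

theorem integrable_conv (f g : C_c(G, A)) (s : G) :
    Integrable (fun t => f t * A.act t (g (t⁻¹ * s))) haar := by
  refine Continuous.integrable_of_hasCompactSupport ?_ f.hasCompactSupport.mul_right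
  exact f.continuous.mul (continuous_act_uncurry.comp
    (continuous_id.prodMk (g.continuous.comp (continuous_inv.mul continuous_const))))

theorem conv_apply (f g : C_c(G, A)) (s : G) :
    conv f g s = ∫ t, f t * A.act t (g (t⁻¹ * s)) ∂haar := rfl

theorem Hom.onCc_conv (φ : Hom A B) (f g : C_c(G, A)) :
    φ.onCc (conv f g) = conv (φ.onCc f) (φ.onCc g) := by
  ext s
  have h := ContinuousLinearMap.integral_comp_comm
    (⟨LinearMapClass.linearMap φ.toHom, φ.continuous⟩ : A →L[ℂ] B) (integrable_conv f g s)
  refine h.symm.trans (integral_congr_ae (Filter.Eventually.of_forall fun t => ?_))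
  change φ (f t * A.act t (g (t⁻¹ * s))) = φ (f t) * B.act t (φ (g (t⁻¹ * s)))
  rw [map_mul, φ.equivariant]

theorem conv_zero (f : C_c(G, A)) : conv f 0 = 0 := by
  ext s
  simp [conv_apply]

end Functoriality

/-! ### The unitization of a `G`-algebra -/

section Unitization

theorem starMap_eq {A B : Type*} [NonUnitalCStarAlgebra A] [NonUnitalCStarAlgebra B]
    (φ : A →⋆ₙₐ[ℂ] B) (x : Unitization ℂ A) :
    Unitization.starMap φ x = Unitization.inl x.fst + (φ x.snd : Unitization ℂ B) := by
  induction x with | _ r c => simp [Algebra.algebraMap_eq_smul_one, Unitization.ext_iff]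

variable {G : Type u} [Group G] [TopologicalSpace G]

/-- The unitization of a `G`-algebra, with the unital extension of the action. -/
noncomputable def unitization (C : GAlgebra G) : GAlgebra G where
  carrier := Unitization ℂ C
  act :=
    { toFun := fun g =>
        { toFun := Unitization.starMap (C.act g : C →⋆ₙₐ[ℂ] C)
          invFun := Unitization.starMap (C.act g⁻¹ : C →⋆ₙₐ[ℂ] C)
          left_inv := fun x => by
            have h : ∀ c : C, C.act g⁻¹ (C.act g c) = c := fun c => by
              rw [← StarAlgEquiv.mul_apply, ← map_mul, inv_mul_cancel, map_one]; rfl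
            simp only [starMap_eq]
            ext
            · simp
            · simpa using h _
          right_inv := fun x => by
            have h : ∀ c : C, C.act g (C.act g⁻¹ c) = c := fun c => by
              rw [← StarAlgEquiv.mul_apply, ← map_mul, mul_inv_cancel, map_one]; rfl
            simp only [starMap_eq]
            ext
            · simp
            · simpa using h _
          map_mul' := map_mul _
          map_add' := map_add _
          map_star' := map_star _
          map_smul' := map_smul _ }
      map_one' := by
        refine StarAlgEquiv.ext fun x => ?_
        refine (starMap_eq (C.act 1 : C →⋆ₙₐ[ℂ] C) x).trans ?_
        rw [map_one]
        ext <;> simp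
      map_mul' := fun g h => by
        refine StarAlgEquiv.ext fun x => ?_
        refine (starMap_eq (C.act (g * h) : C →⋆ₙₐ[ℂ] C) x).trans ?_
        refine Eq.trans ?_ (starMap_eq (C.act g : C →⋆ₙₐ[ℂ] C)
          (Unitization.starMap (C.act h : C →⋆ₙₐ[ℂ] C) x)).symm
        rw [map_mul, starMap_eq]
        ext <;> simp }
  continuous_act := fun x => by
    change Continuous fun g => Unitization.starMap (C.act g : C →⋆ₙₐ[ℂ] C) x
    simp only [starMap_eq]
    exact continuous_const.add (Unitization.continuous_inr.comp (C.continuous_act _))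

theorem unitization_act_apply (C : GAlgebra G) (g : G) (x : Unitization ℂ C) :
    C.unitization.act g x = (Unitization.inl x.fst + (C.act g x.snd : Unitization ℂ C) :
      Unitization ℂ C) :=
  starMap_eq (C.act g : C →⋆ₙₐ[ℂ] C) x

theorem isUnitElement_one (C : GAlgebra G) :
    IsUnitElement (A := C.unitization) (1 : Unitization ℂ C) :=
  fun a => ⟨one_mul (M := Unitization ℂ C) a, mul_one (M := Unitization ℂ C) a⟩

theorem isUnital_unitization (C : GAlgebra G) : C.unitization.IsUnital :=
  ⟨_, isUnitElement_one C⟩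

/-- The inclusion of a `G`-algebra into its unitization. -/
noncomputable def inrHom (C : GAlgebra G) : Hom C C.unitization where
  toHom := Unitization.inrNonUnitalStarAlgHom ℂ C
  equivariant g a := by
    refine Eq.trans ?_ (unitization_act_apply C g (a : Unitization ℂ C)).symm
    change ((C.act g a : C) : Unitization ℂ C) = _
    simp

theorem inrHom_apply (C : GAlgebra G) (c : C) : C.inrHom c = (c : Unitization ℂ C) := rfl

/-- The unital extension to the unitization of a homomorphism into a unital algebra. -/
noncomputable def Hom.lift {C A : GAlgebra G} (π : Hom C A) {e : A} (he : IsUnitElement e) :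
    Hom C.unitization A where
  toHom :=
    { toFun := fun x : Unitization ℂ C => x.fst • e + π x.snd
      map_smul' := fun r x => by
        change Unitization ℂ C at x
        change (r • x).fst • e + π (r • x).snd = r • (x.fst • e + π x.snd)
        simp [smul_smul]
      map_zero' := by
        change (0 : Unitization ℂ C).fst • e + π (0 : Unitization ℂ C).snd = 0
        simp
      map_add' := fun x y => by
        change Unitization ℂ C at x y
        change (x + y).fst • e + π (x + y).snd = (x.fst • e + π x.snd) + (y.fst • e + π y.snd)
        simp only [Unitization.fst_add, Unitization.snd_add, map_add, add_smul]
        abel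
      map_mul' := fun x y => by
        change Unitization ℂ C at x y
        change (x * y).fst • e + π (x * y).snd = (x.fst • e + π x.snd) * (y.fst • e + π y.snd)
        simp only [Unitization.fst_mul, Unitization.snd_mul, map_add, map_smul, map_mul, add_mul,
          mul_add, smul_mul_assoc, mul_smul_comm, (he _).1, (he _).2, mul_smul, smul_add,
          smul_comm y.fst x.fst e]
        abel
      map_star' := fun x => by
        change Unitization ℂ C at x
        change (star x).fst • e + π (star x).snd = star (x.fst • e + π x.snd)
        simp only [Unitization.fst_star, Unitization.snd_star, map_star, star_add, star_smul,
          he.star_eq] }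
  equivariant g x := by
    change Unitization ℂ C at x
    rw [unitization_act_apply]
    change (Unitization.inl x.fst + (C.act g x.snd : Unitization ℂ C)).fst • e
      + π (Unitization.inl x.fst + (C.act g x.snd : Unitization ℂ C)).snd
      = A.act g (x.fst • e + π x.snd)
    simp [he.act_eq, π.equivariant]

variable {C A : GAlgebra G} (π : Hom C A) {e : A} (he : IsUnitElement e)

theorem Hom.lift_apply (x : Unitization ℂ C) : π.lift he x = x.fst • e + π x.snd := rfl

theorem Hom.lift_inrHom (c : C) : π.lift he (C.inrHom c) = π c := by
  rw [inrHom_apply, Hom.lift_apply]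
  simp

theorem Hom.preservesUnit_lift : PreservesUnit (π.lift he) := by
  intro x hx
  rw [isUnitElement_unique hx (isUnitElement_one C), Hom.lift_apply]
  simpa using he

theorem Hom.lift_surjective (hπ : Function.Surjective π) : Function.Surjective (π.lift he) := by
  intro a
  obtain ⟨c, rfl⟩ := hπ a
  exact ⟨C.inrHom c, π.lift_inrHom he c⟩

/-- A lift to the unitization gives a lift to the algebra itself. -/
theorem Hom.exists_onCc_eq_of_lift (hπ : Function.Surjective π) (d : C_c(G, C.unitization)) :
    ∃ c : C_c(G, C), π.onCc c = (π.lift he).onCc d := by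
  -- Any preimage of the unit will do: the map `x ↦ x.fst • c₀ + x.snd` need be neither
  -- multiplicative nor equivariant, since lifting a function requires only continuity.
  obtain ⟨c₀, hc₀⟩ := hπ e
  refine ⟨postcomp (fun x : Unitization ℂ C => x.fst • c₀ + x.snd)
    ((Unitization.continuous_fst.smul continuous_const).add Unitization.continuous_snd)
    ?_ d, ?_⟩
  · change (0 : Unitization ℂ C).fst • c₀ + (0 : Unitization ℂ C).snd = 0
    simp
  ext s
  change π ((d s : Unitization ℂ C).fst • c₀ + (d s : Unitization ℂ C).snd)
    = (d s : Unitization ℂ C).fst • e + π (d s : Unitization ℂ C).snd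
  rw [map_add, map_smul, hc₀]

variable [IsTopologicalGroup G] [LocallyCompactSpace G] [MeasurableSpace G] [BorelSpace G]

open MeasureTheory MeasureTheory.Measure

/-- `C_c(G, C)` is a right ideal in `C_c(G, C⁺¹)`. -/
theorem exists_inrHom_onCc_eq_conv (f : C_c(G, C)) (d : C_c(G, C.unitization)) :
    ∃ h : C_c(G, C), C.inrHom.onCc h = conv (C.inrHom.onCc f) d := by
  -- The scalar part of every integrand vanishes because `C` is an ideal, and it commutes with the
  -- integral; so the convolution equals its `C`-part.
  refine ⟨postcomp (fun x : Unitization ℂ C => x.snd) Unitization.continuous_snd rfl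
    (conv (C.inrHom.onCc f) d), ?_⟩
  ext s
  have h := ContinuousLinearMap.integral_comp_comm
    (⟨⟨⟨fun x => x.fst, Unitization.fst_add⟩, Unitization.fst_smul⟩,
      Unitization.continuous_fst⟩ : Unitization ℂ C →L[ℂ] ℂ)
      (integrable_conv (C.inrHom.onCc f) d s)
  have h0 : (conv (C.inrHom.onCc f) d s : Unitization ℂ C).fst = 0 := by
    refine h.symm.trans ((integral_congr_ae (Filter.Eventually.of_forall fun t => ?_)).trans
      (integral_zero _ _))
    have hm : ∀ (c : C) (y : Unitization ℂ C), ((c : Unitization ℂ C) * y).fst = 0 := by simp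
    exact hm (f t) _
  change ((conv (C.inrHom.onCc f) d s : Unitization ℂ C).snd : Unitization ℂ C)
    = (conv (C.inrHom.onCc f) d s : Unitization ℂ C)
  ext
  · simp [h0]
  · simp

end Unitization
end GAlgebra

/-! ### The relative kernel as a closed self-adjoint ideal -/

namespace CrossedProductFunctor

open GAlgebra

variable {G : Type u} [Group G] [TopologicalSpace G] [IsTopologicalGroup G]
  [LocallyCompactSpace G] [MeasurableSpace G] [BorelSpace G] (μ : CrossedProductFunctor G)
  {A C : GAlgebra G}

theorem norm_inc (f : C_c(G, A)) : ‖μ.inc A f‖ = μ.norm A f := (μ.isCompletion A).norm_eq f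

section RelKernel

variable (π : Hom C A)

theorem inc_mem_relKernel {f : C_c(G, C)} (hf : π.onCc f = 0) : μ.inc C f ∈ μ.relKernel π :=
  Submodule.le_topologicalClosure _
    (Submodule.subset_span ⟨f, (π.onCc_eq_zero_iff f).1 hf, rfl⟩)

theorem isClosed_relKernel : IsClosed (μ.relKernel π : Set (μ.alg C)) :=
  Submodule.isClosed_topologicalClosure _

/-- The functions killed by `π` already form a subspace, so the span adds nothing, and closed
conditions on the relative kernel need checking only on such functions. -/
theorem relKernel_eq_closure :
    (μ.relKernel π : Set (μ.alg C)) = closure (μ.inc C '' {f | π.onCc f = 0}) := by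
  let K : Submodule ℂ C_c(G, C) :=
    { carrier := {f | π.onCc f = 0}
      zero_mem' := by ext s; simp
      add_mem' := fun {f g} hf hg => by
        change π.onCc (f + g) = 0
        rw [Hom.onCc_add, show π.onCc f = 0 from hf, show π.onCc g = 0 from hg, add_zero]
      smul_mem' := fun r f hf => by
        have hf' := (π.onCc_eq_zero_iff f).1 hf
        refine (π.onCc_eq_zero_iff _).2 fun s => ?_
        rw [CompactlySupportedContinuousMap.smul_apply, map_smul, hf' s, smul_zero] }
  have h : {x | ∃ f : C_c(G, C), (∀ s, π (f s) = 0) ∧ x = μ.inc C f}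
      = (K.map (μ.inc C) : Set (μ.alg C)) := by
    ext x
    constructor
    · rintro ⟨f, hf, rfl⟩
      exact ⟨f, (π.onCc_eq_zero_iff f).2 hf, rfl⟩
    · rintro ⟨f, hf, rfl⟩
      exact ⟨f, (π.onCc_eq_zero_iff f).1 hf, rfl⟩
  rw [relKernel, h, Submodule.span_eq, Submodule.topologicalClosure_coe]
  rfl

theorem exists_norm_sub_inc_lt {x : μ.alg C} (hx : x ∈ μ.relKernel π) {ε : ℝ} (hε : 0 < ε) :
    ∃ f : C_c(G, C), π.onCc f = 0 ∧ ‖x - μ.inc C f‖ < ε := by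
  have hx' : x ∈ closure (μ.inc C '' {f | π.onCc f = 0}) := by
    rw [← relKernel_eq_closure]; exact hx
  obtain ⟨_, ⟨f, hf, rfl⟩, h⟩ := Metric.mem_closure_iff.1 hx' ε hε
  exact ⟨f, hf, by rwa [← dist_eq_norm]⟩

theorem relKernel_induction {P : μ.alg C → Prop} (hP : IsClosed {x | P x})
    (h : ∀ f : C_c(G, C), π.onCc f = 0 → P (μ.inc C f)) {x : μ.alg C}
    (hx : x ∈ μ.relKernel π) : P x := by
  have hx' : x ∈ closure (μ.inc C '' {f | π.onCc f = 0}) := by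
    rw [← relKernel_eq_closure]; exact hx
  refine closure_minimal ?_ hP hx'
  rintro _ ⟨f, hf, rfl⟩
  exact h f hf

/-- By density in both factors this reduces to functions, where `f ↦ π ∘ f` respects convolution. -/
theorem mul_mem_relKernel (x y : μ.alg C) (hy : y ∈ μ.relKernel π) : x * y ∈ μ.relKernel π := by
  refine relKernel_induction μ π (P := fun y => x * y ∈ μ.relKernel π)
    ((isClosed_relKernel μ π).preimage (continuous_const.mul continuous_id)) (fun f hf => ?_) hy
  refine (μ.isCompletion C).denseRange.induction_on x
    ((isClosed_relKernel μ π).preimage (continuous_id.mul continuous_const)) fun g => ?_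
  rw [← (μ.isCompletion C).map_conv]
  exact inc_mem_relKernel μ π (by rw [Hom.onCc_conv, hf, conv_zero])

theorem star_mem_relKernel (y : μ.alg C) (hy : y ∈ μ.relKernel π) : star y ∈ μ.relKernel π := by
  refine relKernel_induction μ π (P := fun y => star y ∈ μ.relKernel π)
    ((isClosed_relKernel μ π).preimage continuous_star) (fun f hf => ?_) hy
  rw [← (μ.isCompletion C).map_invol]
  exact inc_mem_relKernel μ π (by rw [Hom.onCc_invol, hf, invol_zero])

theorem map_eq_zero_of_mem_relKernel {x : μ.alg C} (hx : x ∈ μ.relKernel π) : μ.map π x = 0 := by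
  refine relKernel_induction μ π (P := fun x => μ.map π x = 0)
    (isClosed_eq (map_continuous _) continuous_const) (fun f hf => ?_) hx
  rw [μ.map_inc, hf, map_zero]

/-- `μ.map π` is contractive and kills the relative kernel, so it bounds every representative of the
class from below. For `π = id` this shows that the quotient loses no norm. -/
theorem norm_le_norm_mk (c : C_c(G, C)) :
    μ.norm A (π.onCc c) ≤ ‖(Submodule.Quotient.mk (μ.inc C c) : μ.alg C ⧸ μ.relKernel π)‖ := by
  refine le_of_forall_pos_le_add fun ε hε => ?_
  obtain ⟨z, hz, hzn⟩ := Submodule.Quotient.norm_mk_lt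
    (Submodule.Quotient.mk (μ.inc C c) : μ.alg C ⧸ μ.relKernel π) hε
  have h := map_eq_zero_of_mem_relKernel μ π ((Submodule.Quotient.eq _).1 hz)
  rw [map_sub, sub_eq_zero, μ.map_inc] at h
  rw [← norm_inc, ← h]
  exact (NonUnitalStarAlgHom.norm_apply_le _ _).trans hzn.le

end RelKernel

/-! ### Comparing the exact norm with the `μ`-norm -/

theorem bddBelow_piNorm (π : Hom C A) (a : C_c(G, A)) :
    BddBelow {r | ∃ c : C_c(G, C), π.onCc c = a ∧
      r = ‖(Submodule.Quotient.mk (μ.inc C c) : μ.alg C ⧸ μ.relKernel π)‖} :=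
  ⟨0, by rintro _ ⟨c, -, rfl⟩; exact norm_nonneg _⟩

/-- If all functions in `C_c(G, A)` have almost norm-preserving lifts along all surjections onto
`A`, then the `E(μ)`-norm on `C_c(G, A)` is the `μ`-norm. -/
theorem exactNorm_eq_norm
    (h : ∀ (C : GAlgebra G) (π : Hom C A), Function.Surjective π → ∀ (a : C_c(G, A)) (ε : ℝ),
      0 < ε → ∃ c : C_c(G, C), π.onCc c = a ∧
        ‖(Submodule.Quotient.mk (μ.inc C c) : μ.alg C ⧸ μ.relKernel π)‖ ≤ μ.norm A a + ε)
    (a : C_c(G, A)) : μ.exactNorm A a = μ.norm A a := by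
  -- The supremum is attained at `π = id`; the upper bound proved for all `π` also rules out the
  -- default value of `sSup` on unbounded sets.
  refine IsGreatest.csSup_eq ⟨⟨A, Hom.id A, Function.surjective_id, ?_⟩, ?_⟩
  · refine le_antisymm (le_csInf ⟨_, a, rfl, rfl⟩ ?_)
      ((csInf_le (bddBelow_piNorm μ _ a) ⟨a, rfl, rfl⟩).trans
        ((Submodule.Quotient.norm_mk_le _ _).trans (norm_inc μ a).le))
    rintro _ ⟨c, rfl, rfl⟩
    exact norm_le_norm_mk μ (Hom.id A) c
  · rintro _ ⟨C, π, hπ, rfl⟩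
    refine le_of_forall_pos_le_add fun ε hε => ?_
    obtain ⟨c, hc, hcn⟩ := h C π hπ a ε hε
    exact (csInf_le (bddBelow_piNorm μ π a) ⟨c, hc, rfl⟩).trans hcn

theorem isCStarCompletion_exactNorm (h : ∀ a, μ.exactNorm A a = μ.norm A a) :
    IsCStarCompletion (μ.exactNorm A) (μ.inc A) :=
  (funext h : μ.exactNorm A = μ.norm A) ▸ μ.isCompletion A

/-- Composition with an equivariant homomorphism does not increase the `μ`-norm. -/
theorem norm_inc_onCc_le (ψ : Hom A C) (a : C_c(G, A)) :
    ‖μ.inc C (ψ.onCc a)‖ ≤ μ.norm A a := by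
  rw [← μ.map_inc, ← norm_inc]
  exact NonUnitalStarAlgHom.norm_apply_le _ _

/-- If `μ` is functorial for cp maps, then a cp section of `π` is contractive modulo the relative
kernel of `π`. -/
theorem FunctorialForCP.norm_mk_inc_onCc_le (hμ : μ.FunctorialForCP) (π : Hom C A)
    (ψ : CPHom A C) (hψ : ∀ a, π (ψ a) = a) (a : C_c(G, A)) :
    ‖(Submodule.Quotient.mk (μ.inc C (ψ.onCc a)) : μ.alg C ⧸ μ.relKernel π)‖ ≤ μ.norm A a := by
  obtain ⟨Φ, hΦ⟩ := hμ A C ψ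
  have hc : Continuous Φ := map_continuous Φ
  have hsec : ∀ f : C_c(G, A), π.onCc (ψ.onCc f) = f := fun f => by ext s; exact hψ _
  rw [← hΦ, ← norm_inc]
  refine norm_quotient_mk_apply_le _ (isClosed_relKernel μ π) (mul_mem_relKernel μ π)
    (star_mem_relKernel μ π) ⟨LinearMapClass.linearMap Φ, hc⟩ (fun x => ?_) (μ.inc A a)
  change Φ (star x * x) - star (Φ x) * Φ x ∈ μ.relKernel π
  -- By continuity `x` may be taken to come from a function `f`. The defect then comes from a
  -- function that `π` sends to `f^* * f - f^* * f = 0`.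
  refine (μ.isCompletion A).denseRange.induction_on x
    ((isClosed_relKernel μ π).preimage ?_) fun f => ?_
  · exact (hc.comp (continuous_star.mul continuous_id)).sub (hc.star.mul hc)
  · rw [hΦ, ← (μ.isCompletion A).map_invol, ← (μ.isCompletion A).map_conv, hΦ,
      ← (μ.isCompletion C).map_invol, ← (μ.isCompletion C).map_conv, ← map_sub]
    refine inc_mem_relKernel μ π ?_
    rw [Hom.onCc_sub, Hom.onCc_conv, Hom.onCc_invol, hsec, hsec, sub_self]

/-- Lifts which are almost norm-preserving modulo the relative kernel can be changed into almost
norm-preserving lifts. -/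
theorem exists_onCc_eq_norm_lt (π : Hom C A) (c : C_c(G, C)) {ε : ℝ} (hε : 0 < ε) :
    ∃ d : C_c(G, C), π.onCc d = π.onCc c ∧
      ‖μ.inc C d‖ < ‖(Submodule.Quotient.mk (μ.inc C c) : μ.alg C ⧸ μ.relKernel π)‖ + ε := by
  obtain ⟨z, hz, hzn⟩ := Submodule.Quotient.norm_mk_lt
    (Submodule.Quotient.mk (μ.inc C c) : μ.alg C ⧸ μ.relKernel π) (half_pos hε)
  -- The correction `z - c` lies only in the closure; approximating it by a function in the kernel
  -- keeps `c + f` a lift.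
  obtain ⟨f, hf, hfn⟩ := exists_norm_sub_inc_lt μ π ((Submodule.Quotient.eq _).1 hz) (half_pos hε)
  refine ⟨c + f, by rw [Hom.onCc_add, hf, add_zero], ?_⟩
  have h : μ.inc C (c + f) = z - (z - μ.inc C c - μ.inc C f) := by rw [map_add]; abel
  have := norm_sub_le z (z - μ.inc C c - μ.inc C f)
  rw [h]
  linarith

/-- Approximate units of `C ⋊_μ G` in the image of `C_c(G, C)`. -/
theorem exists_norm_inc_conv_sub_lt (c : C_c(G, C)) {ε : ℝ} (hε : 0 < ε) :
    ∃ f : C_c(G, C), ‖μ.inc C f‖ ≤ 1 + ε ∧ ‖μ.inc C c - μ.inc C f * μ.inc C c‖ < ε := by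
  set x := μ.inc C c
  obtain ⟨b, hb, hbx, -⟩ := exists_star_mul_self_approx_unit x (half_pos hε)
  set e := star b * b
  -- The first bound controls `‖f‖`, the second `‖(e - f) x‖`; the `+ 1` avoids division by zero.
  have hδ : 0 < min ε (ε / 2 / (‖x‖ + 1)) := by positivity
  obtain ⟨f, hf⟩ := (μ.isCompletion C).denseRange.exists_dist_lt e hδ
  rw [dist_eq_norm] at hf
  refine ⟨f, ?_, ?_⟩
  · have h1 : ‖μ.inc C f‖ ≤ ‖e‖ + ‖e - μ.inc C f‖ := by
      rw [← norm_neg (e - _)]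
      exact (le_of_eq (by congr 1; abel)).trans (norm_add_le e (-(e - μ.inc C f)))
    linarith [min_le_left ε (ε / 2 / (‖x‖ + 1))]
  · have h2 : ‖(e - μ.inc C f) * x‖ ≤ ε / 2 := by
      refine (norm_mul_le _ _).trans ?_
      calc _ ≤ ε / 2 / (‖x‖ + 1) * (‖x‖ + 1) := by
            gcongr
            · exact hf.le.trans (min_le_right _ _)
            · linarith
        _ = ε / 2 := by field_simp
    have h3 : x - μ.inc C f * x = (e - μ.inc C f) * x - (e * x - x) := by rw [sub_mul]; abel
    rw [h3]
    linarith [norm_sub_le ((e - μ.inc C f) * x) (e * x - x)]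

/-- If `μ` has the ideal property, then the quotient norm for a surjection `π : C → A` onto a unital
algebra can be estimated by means of lifts to the unitization of `C`. -/
theorem IdealProperty.norm_mk_le (hμ : μ.IdealProperty) (π : Hom C A) {e : A}
    (he : IsUnitElement e) (c : C_c(G, C)) (d : C_c(G, C.unitization))
    (hcd : π.onCc c = (π.lift he).onCc d) :
    ‖(Submodule.Quotient.mk (μ.inc C c) : μ.alg C ⧸ μ.relKernel π)‖
      ≤ ‖μ.inc C.unitization d‖ := by
  -- An injective `*`-homomorphism is isometric, so norms of `C`-valued functions may be computed in
  -- the crossed product of the unitization.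
  have hinj : Function.Injective (μ.map C.inrHom) := by
    refine hμ C C.unitization C.inrHom Unitization.inr_injective fun a x => ?_
    change Unitization ℂ C at a
    refine ⟨⟨a.fst • x + a.snd * x, ?_⟩, ⟨a.fst • x + x * a.snd, ?_⟩⟩
    · change ((a.fst • x + a.snd * x : C) : Unitization ℂ C) = a * (x : Unitization ℂ C)
      ext <;> simp
    · change ((a.fst • x + x * a.snd : C) : Unitization ℂ C) = (x : Unitization ℂ C) * a
      ext <;> simp
  have hlift : ∀ f : C_c(G, C), (π.lift he).onCc (C.inrHom.onCc f) = π.onCc f := fun f => by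
    ext s; exact π.lift_inrHom he _
  have key : ∀ ε > 0, ‖(Submodule.Quotient.mk (μ.inc C c) : μ.alg C ⧸ μ.relKernel π)‖
      ≤ ε + (1 + ε) * ‖μ.inc C.unitization d‖ := by
    intro ε hε
    obtain ⟨f, hf1, hf2⟩ := exists_norm_inc_conv_sub_lt μ c hε
    obtain ⟨h, hh⟩ := exists_inrHom_onCc_eq_conv f d
    have hhn : ‖μ.inc C h‖ ≤ (1 + ε) * ‖μ.inc C.unitization d‖ := by
      rw [← NonUnitalStarAlgHom.norm_map (μ.map C.inrHom) hinj, μ.map_inc, hh,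
        (μ.isCompletion _).map_conv, ← μ.map_inc]
      refine (norm_mul_le _ _).trans ?_
      gcongr
      exact (NonUnitalStarAlgHom.norm_apply_le _ _).trans hf1
    -- `c` and `d` live in different algebras, but `f * c` and `h = f * d` are both `C`-valued with
    -- the same image in `C_c(G, A)`; hence `h` may replace `f * c` in the class of `c`.
    have hmem : π.onCc (conv f c - h) = 0 := by
      rw [Hom.onCc_sub, sub_eq_zero, Hom.onCc_conv, hcd, ← hlift h, hh, Hom.onCc_conv, hlift]
    have hq : (Submodule.Quotient.mk (μ.inc C c) : μ.alg C ⧸ μ.relKernel π)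
        = Submodule.Quotient.mk (μ.inc C c - μ.inc C f * μ.inc C c + μ.inc C h) := by
      rw [Submodule.Quotient.eq]
      have := inc_mem_relKernel μ π hmem
      rw [map_sub, (μ.isCompletion C).map_conv] at this
      convert this using 1
      abel
    rw [hq]
    refine (Submodule.Quotient.norm_mk_le _ _).trans ((norm_add_le _ _).trans ?_)
    linarith
  have ht : Filter.Tendsto (fun ε : ℝ => ε + (1 + ε) * ‖μ.inc C.unitization d‖)
      (nhdsWithin 0 (Set.Ioi 0)) (nhds ‖μ.inc C.unitization d‖) := by
    have : Continuous (fun ε : ℝ => ε + (1 + ε) * ‖μ.inc C.unitization d‖) := by fun_prop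
    simpa using (this.tendsto 0).mono_left nhdsWithin_le_nhds
  exact ge_of_tendsto ht (Filter.eventually_of_mem self_mem_nhdsWithin key)

/-- For the ideal property it suffices to lift to unitizations. -/
theorem IdealProperty.exactNorm_eq_norm (hμ : μ.IdealProperty) {e : A} (he : IsUnitElement e)
    (h : ∀ (C : GAlgebra G) (π : Hom C A), Function.Surjective π → ∀ (a : C_c(G, A)) (ε : ℝ),
      0 < ε → ∃ d : C_c(G, C.unitization), (π.lift he).onCc d = a ∧
        ‖μ.inc C.unitization d‖ ≤ μ.norm A a + ε)
    (a : C_c(G, A)) : μ.exactNorm A a = μ.norm A a := by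
  refine CrossedProductFunctor.exactNorm_eq_norm μ (fun C π hπ a ε hε => ?_) a
  obtain ⟨d, hd, hdn⟩ := h C π hπ a ε hε
  obtain ⟨c, hc⟩ := π.exists_onCc_eq_of_lift he hπ d
  exact ⟨c, hc.trans hd, (hμ.norm_mk_le μ π he c d hc).trans hdn⟩

end CrossedProductFunctor

/-! ### The four cases -/

theorem corollary4p5 {G : Type u} [Group G] [TopologicalSpace G] [IsTopologicalGroup G]
    [LocallyCompactSpace G] [T2Space G] [MeasurableSpace G] [BorelSpace G]
    (μ : CrossedProductFunctor G) (A : GAlgebra G) :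
    (A.EquivariantlyProjective →
      GAlgebra.IsCStarCompletion (μ.exactNorm A) (μ.inc A)) ∧
    (μ.IdealProperty → A.UnitallyEquivariantlyProjective →
      GAlgebra.IsCStarCompletion (μ.exactNorm A) (μ.inc A)) ∧
    (μ.FunctorialForCP → A.WELP →
      GAlgebra.IsCStarCompletion (μ.exactNorm A) (μ.inc A)) ∧
    (μ.FunctorialForCP → μ.IdealProperty → A.UWELP →
      GAlgebra.IsCStarCompletion (μ.exactNorm A) (μ.inc A)) := by
  refine ⟨fun hA => ?_, fun hμ hA => ?_, fun hμ hA => ?_, fun hμ hμ' hA => ?_⟩ <;>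
    refine μ.isCStarCompletion_exactNorm ?_
  · refine μ.exactNorm_eq_norm fun C π hπ a ε hε => ?_
    obtain ⟨ψ, hψ⟩ := hA C A π hπ (.id A)
    refine ⟨ψ.onCc a, by ext s; exact hψ _, (Submodule.Quotient.norm_mk_le _ _).trans ?_⟩
    linarith [μ.norm_inc_onCc_le ψ a]
  · obtain ⟨⟨e, he⟩, hA⟩ := hA
    refine hμ.exactNorm_eq_norm μ he fun C π hπ a ε hε => ?_
    obtain ⟨ψ, -, hψ⟩ := hA _ A C.isUnital_unitization ⟨e, he⟩ (π.lift he)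
      (π.preservesUnit_lift he) (π.lift_surjective he hπ) (.id A) fun _ h => h
    refine ⟨ψ.onCc a, by ext s; exact hψ _, ?_⟩
    linarith [μ.norm_inc_onCc_le ψ a]
  · refine μ.exactNorm_eq_norm fun C π hπ a ε hε => ?_
    obtain ⟨ψ, -, hψ⟩ := hA C A π hπ (.id A)
    refine ⟨ψ.onCc a, by ext s; exact hψ _, ?_⟩
    linarith [hμ.norm_mk_inc_onCc_le μ π ψ hψ a]
  · obtain ⟨⟨e, he⟩, hA⟩ := hA
    refine hμ'.exactNorm_eq_norm μ he fun C π hπ a ε hε => ?_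
    obtain ⟨ψ, -, -, hψ⟩ := hA _ A C.isUnital_unitization ⟨e, he⟩ (π.lift he)
      (π.preservesUnit_lift he) (π.lift_surjective he hπ) (.id A) fun _ h => h
    -- The cp section gives a bound only modulo the relative kernel, while the unitization criterion
    -- needs an actual norm bound; hence the change of lift, at the cost of `ε`.
    obtain ⟨d, hd, hdn⟩ := μ.exists_onCc_eq_norm_lt (π.lift he) (ψ.onCc a) hε
    refine ⟨d, hd.trans (by ext s; exact hψ _), ?_⟩
    linarith [hμ.norm_mk_inc_onCc_le μ (π.lift he) ψ hψ a]
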